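/- Let $K$ be a field and let $R=K[\mathbf x_1;\dots;\mathbf x_r]$, $\mathbf x_j=(x^{(j)}_0,\dots,x^{(j)}_{n_j})$, and $S=K[\mathbf y_1;\dots;\mathbf y_s]$, $\mathbf y_i=(y^{(i)}_0,\dots,y^{(i)}_{m_i})$, carry the standard $\mathbb Z^r$- and $\mathbb Z^s$-gradings (each variable of the $j$-th group has degree the $j$-th standard basis vector). Let $I\subset R$ and $J\subset S$ be homogeneous, multi-saturated (that is, unchanged by successive saturation with respect to the ideals generated by each group of variables), absolutely prime ideals, and let $X=V(I)\subseteq\mathbb P^{n_1}\times\dots\times\mathbb P^{n_r}$ and $Y=V(J)\subseteq\mathbb P^{m_1}\times\dots\times\mathbb P^{m_s}$ be the multi-projective varieties they define (points are taken over $\overline K$). A *representative vector* on $X$ is a non-zero vector $\mathbf F=(F_0,\dots,F_m)\in (R/I)^{m+1}$ of forms of the same multi-degree; two such vectors are equivalent if the maps $p\mapsto(F_0(p):\dots:F_m(p))\in\mathbb P^m$ they define agree at every point of $X$ at which both are defined. A rational map $X\dashrightarrow\mathbb P^m$ is an equivalence class; its elements are its *representatives*, and its *module of representatives* is the $(R/I)$-submodule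 of $(R/I)^{m+1}$ that they generate. It is defined at $p$ if some representative does not vanish at $p$. A multi-rational map $\Phi=(\Phi_1,\dots,\Phi_s):X\dashrightarrow Y$ is a tuple of rational maps $\Phi_i:X\dashrightarrow\mathbb P^{m_i}$ such that $\Phi(p)=(\Phi_1(p),\dots,\Phi_s(p))\in Y$ whenever all $\Phi_i$ are defined at $p$; it is dominant if its image is Zariski dense in $Y$. It is birational if it is dominant and has an inverse, that is, a dominant multi-rational map $\Psi=(\Psi_1,\dots,\Psi_r):Y\dashrightarrow X$ with $\Psi\circ\Phi=\mathrm{id}_X$ and $\Phi\circ\Psi=\mathrm{id}_Y$ as rational maps. The same notions are used with $X$ and $Y$ exchanged. Let $\Phi:X\dashrightarrow Y$ be birational with inverse $\Psi$, and let $\mathbf F^{(1)},\dots,\mathbf F^{(s)}$ be (lifts to $R$ of) representatives of $\Phi_1,\dots,\Phi_s$. The ideal of the graph of $\Phi$ is the ideal $$\mathcal G=\Big(I+\sum_{i=1}^s(\mathbf y_i-t_i\mathbf F^{(i)})\Big)\cap T$$ of the $\mathbb Z^r\times\mathbb Z^s$-graded ring $T=K[\mathbf x_1;\dots;\mathbf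 x_r;\mathbf y_1;\dots;\mathbf y_s]$, where the ideal in parentheses is formed in $T[t_1,\dots,t_s]$. Fix a minimal set $\mathcal H$ of multi-forms generating $\mathcal G$. For $j\in\{1,\dots,r\}$ let $H_1,\dots,H_q$ be the elements of $\mathcal H$ of multi-degree $(0,\dots,0,1,0,\dots,0;d_1,\dots,d_s)$ with $1$ at position $j$ and arbitrary $d_1,\dots,d_s$, write $$H_k=\sum_{\iota=0}^{n_j}x^{(j)}_\iota\,G^{(j,k)}_\iota,\qquad G^{(j,k)}_\iota\in S,$$ and let $\mathfrak J^{(j)}=\big(G^{(j,k)}_\iota\big)_{k=1,\dots,q}^{\iota=0,\dots,n_j}$, regarded as a $q\times(n_j+1)$ matrix over $S/J$. Then for every $j=1,\dots,r$: 1. the $(S/J)$-module of representatives of $\Psi_j$ is $\ker\mathfrak J^{(j)}\subseteq(S/J)^{n_j+1}$, and the representatives of $\Psi_j$ are exactly the non-zero vectors of forms of the same multi-degree in $\ker\mathfrak J^{(j)}$; 2. $\mathfrak J^{(j)}$ has rank $n_j$; 3. for every $n_j\times(n_j+1)$ submatrix of $\mathfrak J^{(j)}$ of rank $n_j$, the vector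 of its signed $n_j\times n_j$ minors is a representative of $\Psi_j$. -/

import Mathlib

noncomputable section

open scoped LinearAlgebra.Projectivization

namespace MultiProj

/-- The variables `x_0^{(j)}, …, x_{n_j}^{(j)}`, `j = 1, …, r`, of the coordinate ring of
`ℙ^{n_1} × ⋯ × ℙ^{n_r}`. -/
abbrev Vars {r : ℕ} (n : Fin r → ℕ) : Type := Σ j : Fin r, Fin (n j + 1)

/-- The polynomial ring in `r` groups of variables. -/
abbrev PolyRing (K : Type*) [Field K] {r : ℕ} (n : Fin r → ℕ) : Type _ :=
  MvPolynomial (Vars n) K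

/-- The standard multi-grading: `x_i^{(j)}` has degree the `j`-th standard basis vector. -/
def weight {r : ℕ} (n : Fin r → ℕ) (v : Vars n) : Fin r → ℕ := Pi.single v.1 1

/-- `f` is a homogeneous polynomial of multi-degree `d`. -/
abbrev IsForm {K : Type*} [Field K] {r : ℕ} {n : Fin r → ℕ} (f : PolyRing K n)
    (d : Fin r → ℕ) : Prop :=
  MvPolynomial.IsWeightedHomogeneous (weight n) f d

/-- The saturation `𝔞 : 𝔟^∞`. -/
def saturateBy {A : Type*} [CommRing A] (𝔞 𝔟 : Ideal A) : Ideal A :=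
  ⨆ k : ℕ, Submodule.colon 𝔞 ((𝔟 ^ k : Ideal A) : Set A)

/-- The ideal `(x_0^{(j)}, …, x_{n_j}^{(j)})`. -/
def blockIdeal (K : Type*) [Field K] {r : ℕ} (n : Fin r → ℕ) (j : Fin r) :
    Ideal (PolyRing K n) :=
  Ideal.span (Set.range fun i : Fin (n j + 1) => (MvPolynomial.X ⟨j, i⟩ : PolyRing K n))

/-- The multi-saturation: saturate successively by the ideals of the groups of variables. -/
def multiSaturation {K : Type*} [Field K] {r : ℕ} {n : Fin r → ℕ} (𝔞 : Ideal (PolyRing K n)) :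
    Ideal (PolyRing K n) :=
  (List.finRange r).foldl (fun 𝔠 j => saturateBy 𝔠 (blockIdeal K n j)) 𝔞

/-- An absolutely irreducible multi-projective variety in `ℙ^{n_1} × ⋯ × ℙ^{n_r}` over `K`,
given by its multi-saturated homogeneous absolutely prime ideal. -/
structure Variety (K : Type*) [Field K] {r : ℕ} (n : Fin r → ℕ) where
  ideal : Ideal (PolyRing K n)
  homogeneous : ∀ f ∈ ideal, ∀ d : Fin r → ℕ,
    MvPolynomial.weightedHomogeneousComponent (weight n) d f ∈ ideal
  saturated : multiSaturation ideal = ideal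
  absolutelyPrime :
    (ideal.map (MvPolynomial.map (algebraMap K (AlgebraicClosure K)))).IsPrime

/-- The geometric points of `ℙ^{n_1} × ⋯ × ℙ^{n_r}`. -/
abbrev Point (K : Type*) [Field K] {r : ℕ} (n : Fin r → ℕ) : Type _ :=
  ∀ j : Fin r, ℙ (AlgebraicClosure K) (Fin (n j + 1) → AlgebraicClosure K)

/-- A choice of homogeneous coordinates of a point. -/
def Point.coords {K : Type*} [Field K] {r : ℕ} {n : Fin r → ℕ} (p : Point K n) :
    Vars n → AlgebraicClosure K :=
  fun v => (p v.1).rep v.2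

namespace Variety

variable {K : Type*} [Field K] {r : ℕ} {n : Fin r → ℕ}

/-- The homogeneous coordinate ring. -/
abbrev CoordRing (X : Variety K n) : Type _ := PolyRing K n ⧸ X.ideal

/-- The set of geometric points of `X`: the common zeros of the forms in its ideal. -/
def points (X : Variety K n) : Set (Point K n) :=
  {p | ∀ f ∈ X.ideal, (∃ d, IsForm f d) → MvPolynomial.aeval p.coords f = 0}

theorem aeval_eq_zero (X : Variety K n) {p : Point K n} (hp : p ∈ X.points)
    (f : PolyRing K n) (hf : f ∈ X.ideal) : MvPolynomial.aeval p.coords f = 0 := by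
  rw [← MvPolynomial.sum_weightedHomogeneousComponent (weight n) f,
    finsum_eq_sum _ (MvPolynomial.weightedHomogeneousComponent_finsupp f), map_sum]
  exact Finset.sum_eq_zero fun d _ => hp _ (X.homogeneous f hf d)
    ⟨d, MvPolynomial.weightedHomogeneousComponent_isWeightedHomogeneous d f⟩

/-- Evaluation of elements of the coordinate ring at (the chosen coordinates of) a point. -/
def evalAt (X : Variety K n) (p : X.points) : X.CoordRing →+* AlgebraicClosure K :=
  Ideal.Quotient.lift X.ideal
    (MvPolynomial.aeval (R := K) p.1.coords : PolyRing K n →ₐ[K] AlgebraicClosure K).toRingHom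
    (X.aeval_eq_zero p.2)

/-- The vector `(F_0(p), …, F_m(p))`. -/
def evalVec (X : Variety K n) {m : ℕ} (F : Fin (m + 1) → X.CoordRing) (p : X.points) :
    Fin (m + 1) → AlgebraicClosure K :=
  fun i => X.evalAt p (F i)

/-- `F` is a non-zero vector of forms in the coordinate ring, all of the same multi-degree. -/
def IsFormVector (X : Variety K n) {m : ℕ} (F : Fin (m + 1) → X.CoordRing) : Prop :=
  F ≠ 0 ∧ ∃ d : Fin r → ℕ, ∀ i, ∃ f : PolyRing K n,
    IsForm f d ∧ Ideal.Quotient.mk X.ideal f = F i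

/-- `F ∼ G`: the maps `p ↦ (F_0(p) : … : F_m(p))` and `p ↦ (G_0(p) : … : G_m(p))` agree wherever
both are defined. -/
def SameMap (X : Variety K n) {m : ℕ} (F G : Fin (m + 1) → X.CoordRing) : Prop :=
  ∀ (p : X.points) (hF : X.evalVec F p ≠ 0) (hG : X.evalVec G p ≠ 0),
    Projectivization.mk (AlgebraicClosure K) (X.evalVec F p) hF =
      Projectivization.mk (AlgebraicClosure K) (X.evalVec G p) hG

end Variety

/-- A rational map `X ⇢ ℙ^m`: an equivalence class of non-zero vectors of `m + 1` forms of the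
same multi-degree in the coordinate ring of `X`. The elements of the class are the
representatives. -/
structure RationalMap {K : Type*} [Field K] {r : ℕ} {n : Fin r → ℕ} (X : Variety K n)
    (m : ℕ) where
  reps : Set (Fin (m + 1) → X.CoordRing)
  isClass : ∃ F, X.IsFormVector F ∧ reps = {G | X.IsFormVector G ∧ X.SameMap F G}

namespace RationalMap

variable {K : Type*} [Field K] {r : ℕ} {n : Fin r → ℕ} {X : Variety K n} {m : ℕ}

/-- `φ` is defined at `p`, with value `q`. -/
def HasValue (φ : RationalMap X m) (p : X.points)
    (q : ℙ (AlgebraicClosure K) (Fin (m + 1) → AlgebraicClosure K)) : Prop :=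
  ∃ F ∈ φ.reps, ∃ hF : X.evalVec F p ≠ 0,
    Projectivization.mk (AlgebraicClosure K) (X.evalVec F p) hF = q

/-- The module of representatives: the submodule generated by the representatives. -/
def repModule (φ : RationalMap X m) : Submodule X.CoordRing (Fin (m + 1) → X.CoordRing) :=
  Submodule.span X.CoordRing φ.reps

end RationalMap

/-- A multi-rational map `X ⇢ Y ⊆ ℙ^{m_1} × ⋯ × ℙ^{m_s}`: a tuple of rational maps
`X ⇢ ℙ^{m_i}` that sends the points where all of them are defined into `Y`. -/
structure MultiRationalMap {K : Type*} [Field K] {r s : ℕ} {n : Fin r → ℕ} {m : Fin s → ℕ}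
    (X : Variety K n) (Y : Variety K m) where
  comp : ∀ i : Fin s, RationalMap X (m i)
  mapsTo : ∀ (p : X.points) (q : Point K m), (∀ i, (comp i).HasValue p (q i)) → q ∈ Y.points

namespace MultiRationalMap

variable {K : Type*} [Field K] {r s : ℕ} {n : Fin r → ℕ} {m : Fin s → ℕ}
  {X : Variety K n} {Y : Variety K m}

/-- `Φ` is defined at `p`, with value `q`. -/
def HasValue (Φ : MultiRationalMap X Y) (p : X.points) (q : Y.points) : Prop :=
  ∀ i, (Φ.comp i).HasValue p (q.1 i)

/-- The image of `Φ` is Zariski dense in `Y`: a form that vanishes on the image vanishes on `Y`. -/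
def Dominant (Φ : MultiRationalMap X Y) : Prop :=
  ∀ (g : PolyRing K m) (d : Fin s → ℕ), IsForm g d →
    (∀ p q, Φ.HasValue p q → MvPolynomial.aeval q.1.coords g = 0) →
    ∀ q ∈ Y.points, MvPolynomial.aeval q.coords g = 0

/-- `Φ` and `Ψ` are mutually inverse dominant multi-rational maps: both composites, which are
defined on non-empty open sets because of dominance, agree there with the identity. In particular
`Φ` is birational. -/
structure IsInverse (Φ : MultiRationalMap X Y) (Ψ : MultiRationalMap Y X) : Prop where
  dominant : Φ.Dominant
  dominant_inv : Ψ.Dominant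
  left_inv : ∀ p q p', Φ.HasValue p q → Ψ.HasValue q p' → p' = p
  right_inv : ∀ q p q', Ψ.HasValue q p → Φ.HasValue p q' → q' = q

end MultiRationalMap

section Graph

variable {K : Type*} [Field K] {r s : ℕ} {n : Fin r → ℕ} {m : Fin s → ℕ}

/-- The coordinate ring `T = K[𝐱_1; …; 𝐱_r; 𝐲_1; …; 𝐲_s]` of
`ℙ^{n_1} × ⋯ × ℙ^{n_r} × ℙ^{m_1} × ⋯ × ℙ^{m_s}`. -/
abbrev BiRing (K : Type*) [Field K] {r s : ℕ} (n : Fin r → ℕ) (m : Fin s → ℕ) : Type _ :=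
  MvPolynomial (Vars n ⊕ Vars m) K

/-- The standard `ℤ^r × ℤ^s`-grading of `T`. -/
def biWeight (n : Fin r → ℕ) (m : Fin s → ℕ) :
    Vars n ⊕ Vars m → (Fin r → ℕ) × (Fin s → ℕ) :=
  Sum.elim (fun v => (weight n v, 0)) (fun w => (0, weight m w))

/-- `h ∈ T` is homogeneous of multi-degree `d`. -/
abbrev IsBiForm (h : BiRing K n m) (d : (Fin r → ℕ) × (Fin s → ℕ)) : Prop :=
  MvPolynomial.IsWeightedHomogeneous (biWeight n m) h d

/-- The extended polynomial ring `K[t_1, …, t_s; 𝐱_1; …; 𝐱_r; 𝐲_1; …; 𝐲_s]`. -/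
abbrev ExtRing (K : Type*) [Field K] {r s : ℕ} (n : Fin r → ℕ) (m : Fin s → ℕ) : Type _ :=
  MvPolynomial (Fin s ⊕ (Vars n ⊕ Vars m)) K

/-- The ideal `I + ∑_i (𝐲_i - t_i 𝐅^{(i)})` of the extended polynomial ring. -/
def extGraphIdeal (X : Variety K n) (F : ∀ i : Fin s, Fin (m i + 1) → PolyRing K n) :
    Ideal (ExtRing K n m) :=
  X.ideal.map (MvPolynomial.rename (fun v : Vars n =>
      (Sum.inr (Sum.inl v) : Fin s ⊕ (Vars n ⊕ Vars m))) : PolyRing K n →ₐ[K] ExtRing K n m) ⊔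
    ⨆ i : Fin s, Ideal.span (Set.range fun k : Fin (m i + 1) =>
      (MvPolynomial.X (Sum.inr (Sum.inr ⟨i, k⟩)) - MvPolynomial.X (Sum.inl i) *
        MvPolynomial.rename (fun v : Vars n => Sum.inr (Sum.inl v)) (F i k) : ExtRing K n m))

/-- The homogeneous ideal of the graph: the contraction of `extGraphIdeal` to `T`. Here `F i` is a
lift to the polynomial ring of a representative of the `i`-th component of the map. -/
def graphIdeal (X : Variety K n) (F : ∀ i : Fin s, Fin (m i + 1) → PolyRing K n) :
    Ideal (BiRing K n m) :=
  (extGraphIdeal X F).comap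
    (MvPolynomial.rename Sum.inr : BiRing K n m →ₐ[K] ExtRing K n m)

/-- `𝓗` is a minimal set of multi-forms generating the ideal `𝔞`. -/
def IsMinimalFormGenerators (𝔞 : Ideal (BiRing K n m)) (𝓗 : Set (BiRing K n m)) : Prop :=
  Minimal (fun A : Set (BiRing K n m) => (∀ h ∈ A, ∃ d, IsBiForm h d) ∧ Ideal.span A = 𝔞) 𝓗

/-- The members of `𝓗` of multi-degree `(0, …, 1, …, 0; d_1, …, d_s)`, with `1` at
position `j`. -/
def linearForms (𝓗 : Set (BiRing K n m)) (j : Fin r) : Set (BiRing K n m) :=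
  {h ∈ 𝓗 | ∃ d : Fin s → ℕ, IsBiForm h (Pi.single j 1, d)}

/-- The coefficient `G_i ∈ S` of `x_i^{(j)}` in `h`, viewed as a polynomial in the `𝐱`-variables
with coefficients in `S = K[𝐲_1; …; 𝐲_s]`. For `h` in `linearForms 𝓗 j` one has
`h = ∑_i x_i^{(j)} G_i`. -/
def linearCoeff (j : Fin r) (i : Fin (n j + 1)) (h : BiRing K n m) : PolyRing K m :=
  MvPolynomial.coeff (Finsupp.single ⟨j, i⟩ 1)
    (MvPolynomial.sumAlgEquiv K (Vars n) (Vars m) h)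

/-- The `j`-th Jacobian dual matrix, over the coordinate ring of `Y`; its rows are indexed by the
selected generators. -/
def jacobianDual (Y : Variety K m) (𝓗 : Set (BiRing K n m)) (j : Fin r) :
    Matrix (linearForms 𝓗 j) (Fin (n j + 1)) Y.CoordRing :=
  Matrix.of fun h i => Ideal.Quotient.mk Y.ideal (linearCoeff j i h.1)

end Graph

/-- The vector of signed maximal minors of a `k × (k + 1)` matrix. -/
def signedMinors {A : Type*} [CommRing A] {k : ℕ} (M : Matrix (Fin k) (Fin (k + 1)) A) :
    Fin (k + 1) → A :=
  fun i => (-1) ^ (i : ℕ) * (M.submatrix id i.succAbove).det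

end MultiProj

end

/-!
Let `𝐆` be a vector of forms representing the component `Ψ_j` of the inverse. Everything follows
from one relation on `X`, `x_a G_b(𝐅) = x_b G_a(𝐅)` for the variables of the `j`-th group
(`MultiRationalMap.IsInverse.X_mul_aeval_eq`): it says that `Ψ_j ∘ Φ` is the `j`-th projection. It
holds at the points where `Φ` and `Ψ ∘ Φ` are given by the chosen representatives, hence in the
coordinate ring of `X` by the multi-projective Nullstellensatz
(`Variety.mem_ideal_of_forall_points`). Combined with dominance, in the form that a form `g` with
`g(𝐅) = 0` on `X` lies in the ideal `J` of `Y` (`MultiRationalMap.Dominant.mem_ideal`), it has two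
consequences.

* `𝐆` lies in the kernel of the Jacobian dual matrix (`mem_ker_of_mem_reps`). For an equation
  `h = ∑ x_i L_i(𝐲)` of the graph, `x_b ∑ L_i(𝐅) G_i(𝐅) = h(𝐱, 𝐅) G_b(𝐅) = 0` on `X`, so
  `∑ L_i G_i` lies in `J`.
* Every kernel vector is proportional to `𝐆` (`mul_eq_mul_of_mem_ker`), because
  `x_a G_b(𝐲) - x_b G_a(𝐲)` is an equation of the graph, and kernel vectors are syzygies of the
  linear parts of all such equations (`sum_linearCoeff_eq_zero`).

So the kernel has rank one, which gives the rank of the matrix. As proportional vectors of forms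
define the same rational map (`RationalMap.mem_reps_iff`), the representatives are the vectors of
forms in the kernel, and these generate the kernel because it is graded
(`ker_le_span_formVectors`). For a submatrix with `n_j` rows and rank `n_j`, the vector of signed
minors and `𝐆` both lie in the kernel of the submatrix, which has rank one, so they are
proportional.
-/

noncomputable section
open scoped LinearAlgebra.Projectivization

namespace MultiProj

/-! ### Forms and substitution -/

section Forms

open MvPolynomial

variable {K : Type*} [Field K] {r s : ℕ} {n : Fin r → ℕ} {m : Fin s → ℕ}

theorem weight_apply (a : Vars n →₀ ℕ) (j : Fin r) :
    Finsupp.weight (weight n) a j = ∑ i, a ⟨j, i⟩ := by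
  rw [Finsupp.weight_apply, Finsupp.sum_fintype _ _ (by simp), Finset.sum_apply,
    Fintype.sum_sigma, Finset.sum_eq_single j]
  · simp [weight]
  · intro b _ hb
    simp [weight, Pi.single_eq_of_ne' hb]
  · simp

/-- Rescaling each group of variables by its own factor rescales the values of a form. -/
theorem aeval_scale {A : Type*} [CommRing A] [Algebra K A] {f : PolyRing K n} {d : Fin r → ℕ}
    (hf : IsForm f d) (c : Fin r → A) (x : Vars n → A) :
    aeval (fun v => c v.1 * x v) f = (∏ j, c j ^ d j) * aeval x f := by
  simp only [aeval_def, eval₂_eq, Finset.mul_sum]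
  refine Finset.sum_congr rfl fun a ha => ?_
  have hd : Finsupp.weight (weight n) a = d := hf (mem_support_iff.1 ha)
  have : ∏ v ∈ a.support, (c v.1 * x v) ^ a v =
      (∏ j, c j ^ d j) * ∏ v ∈ a.support, x v ^ a v := by
    rw [Finset.prod_congr rfl fun v _ => mul_pow _ _ _, Finset.prod_mul_distrib]
    congr 1
    rw [Finset.prod_subset (Finset.subset_univ _) fun v _ hv => by
        rw [Finsupp.notMem_support_iff.1 hv, pow_zero], Fintype.prod_sigma]
    refine Finset.prod_congr rfl fun j _ => ?_
    rw [← hd, weight_apply]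
    exact Finset.prod_pow_eq_pow_sum Finset.univ (fun i => a ⟨j, i⟩) (c j)
  rw [this]
  ring

/-- Substituting forms whose multi-degree depends only on the group of the variable into a form
gives a form. -/
theorem IsForm.aeval {g : PolyRing K m} {d : Fin s → ℕ} (hg : IsForm g d)
    {φ : ∀ i : Fin s, Fin (m i + 1) → PolyRing K n} {e : Fin s → Fin r → ℕ}
    (hφ : ∀ i k, IsForm (φ i k) (e i)) :
    IsForm (MvPolynomial.aeval (fun v : Vars m => φ v.1 v.2) g) (∑ i, d i • e i) := by
  rw [aeval_def, eval₂_eq]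
  refine IsWeightedHomogeneous.sum _ _ _ fun a ha => ?_
  have hd : Finsupp.weight (weight m) a = d := hg (mem_support_iff.1 ha)
  rw [← zero_add (∑ i, d i • e i)]
  refine IsWeightedHomogeneous.mul (isWeightedHomogeneous_C _ _) ?_
  have : ∑ i, d i • e i = ∑ v ∈ a.support, a v • e v.1 := by
    rw [Finset.sum_subset (Finset.subset_univ a.support) fun v _ hv => by
        rw [Finsupp.notMem_support_iff.1 hv, zero_smul], Fintype.sum_sigma]
    refine Finset.sum_congr rfl fun j _ => ?_
    rw [← hd, weight_apply]
    exact Finset.sum_smul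
  rw [this]
  exact IsWeightedHomogeneous.prod _ _ _ fun v _ => (hφ _ _).pow _

theorem isForm_X (j : Fin r) (i : Fin (n j + 1)) :
    IsForm (X ⟨j, i⟩ : PolyRing K n) (Pi.single j 1) :=
  isWeightedHomogeneous_X _ _ _

end Forms

/-! ### Bihomogeneous polynomials -/

section BiForms

open MvPolynomial

variable {K : Type*} [Field K] {r s : ℕ} {n : Fin r → ℕ} {m : Fin s → ℕ}

theorem weight_biWeight_sumElim (a : Vars n →₀ ℕ) (b : Vars m →₀ ℕ) :
    Finsupp.weight (biWeight n m) (Finsupp.sumElim a b) =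
      (Finsupp.weight (weight n) a, Finsupp.weight (weight m) b) := by
  simp only [Finsupp.weight_apply]
  rw [Finsupp.sum_fintype _ _ (by simp), Finsupp.sum_fintype _ _ (by simp),
    Finsupp.sum_fintype _ _ (by simp), Fintype.sum_sum_type]
  ext j <;> simp [biWeight, Prod.fst_sum, Prod.snd_sum]

theorem coeff_coeff_sumAlgEquiv (h : BiRing K n m) (a : Vars n →₀ ℕ) (b : Vars m →₀ ℕ) :
    coeff b (coeff a (sumAlgEquiv K (Vars n) (Vars m) h)) = coeff (Finsupp.sumElim a b) h := by
  simp [sumAlgEquiv, coeff, AddMonoidAlgebra.curryAlgEquiv, AddMonoidAlgebra.curryRingEquiv,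
    AddMonoidAlgebra.curryAddEquiv]

/-- The coefficients of a bihomogeneous polynomial, seen as a polynomial in the first groups of
variables, are forms in the second ones. -/
theorem IsBiForm.coeff {h : BiRing K n m} {d : Fin r → ℕ} {e : Fin s → ℕ}
    (hh : IsBiForm h (d, e)) (a : Vars n →₀ ℕ) :
    IsForm (coeff a (sumAlgEquiv K (Vars n) (Vars m) h)) e := by
  intro b hb
  rw [coeff_coeff_sumAlgEquiv] at hb
  have := hh hb
  rw [weight_biWeight_sumElim] at this
  exact congrArg Prod.snd this

theorem IsBiForm.weight_eq {h : BiRing K n m} {d : Fin r → ℕ} {e : Fin s → ℕ}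
    (hh : IsBiForm h (d, e)) {a : Vars n →₀ ℕ}
    (ha : MvPolynomial.coeff a (sumAlgEquiv K (Vars n) (Vars m) h) ≠ 0) :
    Finsupp.weight (weight n) a = d := by
  obtain ⟨b, hb⟩ := ne_zero_iff.1 ha
  rw [coeff_coeff_sumAlgEquiv] at hb
  have := hh hb
  rw [weight_biWeight_sumElim] at this
  exact congrArg Prod.fst this

theorem weight_eq_zero {a : Vars n →₀ ℕ} (ha : Finsupp.weight (weight n) a = 0) : a = 0 := by
  ext ⟨j, i⟩
  have := congrFun ha j
  rw [weight_apply] at this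
  simpa using (Finset.sum_eq_zero_iff.1 this) i (Finset.mem_univ _)

theorem weight_single (j : Fin r) (i : Fin (n j + 1)) :
    Finsupp.weight (weight n) (Finsupp.single ⟨j, i⟩ 1) = Pi.single j 1 := by
  rw [Finsupp.weight_single, one_smul]; rfl

theorem exists_eq_single {a : Vars n →₀ ℕ} {j : Fin r}
    (ha : Finsupp.weight (weight n) a = Pi.single j 1) :
    ∃ i, a = Finsupp.single ⟨j, i⟩ 1 := by
  have h1 : ∑ i, a ⟨j, i⟩ = 1 := by rw [← weight_apply, ha, Pi.single_eq_same]
  obtain ⟨i, hi⟩ : ∃ i, a ⟨j, i⟩ ≠ 0 := by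
    by_contra! h0
    simp [h0] at h1
  refine ⟨i, ?_⟩
  have hle : Finsupp.single ⟨j, i⟩ 1 ≤ a := by
    rw [Finsupp.single_le_iff]; omega
  obtain ⟨b, rfl⟩ := exists_add_of_le hle
  rw [map_add, weight_single] at ha
  rw [weight_eq_zero (add_eq_left.1 ha), add_zero]

/-- Evaluation of a polynomial in two sets of variables, one set after the other. -/
theorem aeval_sumElim_eq {A : Type*} [CommRing A] [Algebra K A] (x : Vars n → A) (y : Vars m → A)
    (h : BiRing K n m) :
    aeval (Sum.elim x y) h =
      eval₂ (aeval y : PolyRing K m →ₐ[K] A).toRingHom x (sumAlgEquiv K (Vars n) (Vars m) h) := by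
  induction h using MvPolynomial.induction_on with
  | C c => simp
  | add p q hp hq => rw [map_add, map_add, hp, hq, eval₂_add]
  | mul_X p v hp => rcases v with v | v <;> simp [hp, eval₂_mul]

/-- The degree-zero part of a polynomial with respect to the first groups of variables. -/
def constCoeff (h : BiRing K n m) : PolyRing K m :=
  coeff 0 (sumAlgEquiv K (Vars n) (Vars m) h)

theorem aeval_eq_constCoeff {A : Type*} [CommRing A] [Algebra K A] (x : Vars n → A)
    (y : Vars m → A) {h : BiRing K n m} {e : Fin s → ℕ} (hh : IsBiForm h (0, e)) :
    aeval (Sum.elim x y) h = aeval y (constCoeff h) := by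
  have : sumAlgEquiv K (Vars n) (Vars m) h = C (constCoeff h) := by
    ext1 a
    rw [coeff_C]
    split_ifs with h0
    · rw [← h0]; rfl
    · by_contra hne
      exact h0 (weight_eq_zero (hh.weight_eq hne)).symm
  rw [aeval_sumElim_eq, this, eval₂_C]
  rfl

theorem aeval_eq_sum_linearCoeff {A : Type*} [CommRing A] [Algebra K A] (x : Vars n → A)
    (y : Vars m → A) {h : BiRing K n m} {j : Fin r} {e : Fin s → ℕ}
    (hh : IsBiForm h (Pi.single j 1, e)) :
    aeval (Sum.elim x y) h = ∑ i, x ⟨j, i⟩ * aeval y (linearCoeff j i h) := by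
  have : sumAlgEquiv K (Vars n) (Vars m) h = ∑ i, C (linearCoeff j i h) * X ⟨j, i⟩ := by
    ext1 a
    simp only [coeff_sum, coeff_C_mul, coeff_X]
    by_cases hne : MvPolynomial.coeff a (sumAlgEquiv K (Vars n) (Vars m) h) = 0
    · rw [hne, Finset.sum_eq_zero]
      intro i _
      split_ifs with hi
      · rw [linearCoeff, hi, hne, zero_mul]
      · rw [mul_zero]
    · obtain ⟨i, rfl⟩ := exists_eq_single (hh.weight_eq hne)
      rw [Finset.sum_eq_single i]
      · simp [linearCoeff]
      · intro b _ hb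
        rw [if_neg, mul_zero]
        intro h
        have := (Finsupp.single_left_inj one_ne_zero).1 h
        exact hb (by simpa using this)
      · simp
  rw [aeval_sumElim_eq, this, eval₂_sum]
  simp [eval₂_mul, mul_comm]

theorem constCoeff_mul (a h : BiRing K n m) :
    constCoeff (a * h) = constCoeff a * constCoeff h := by
  simp [constCoeff, ← constantCoeff_eq]

theorem linearCoeff_mul (a h : BiRing K n m) (j : Fin r) (i : Fin (n j + 1)) :
    linearCoeff j i (a * h) =
      constCoeff a * linearCoeff j i h + linearCoeff j i a * constCoeff h := by
  classical
  simp only [constCoeff, linearCoeff, map_mul, coeff_mul]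
  rw [Finsupp.antidiagonal_single]
  simp [Finset.Nat.antidiagonal_succ]

theorem constCoeff_eq_zero {h : BiRing K n m} {d : Fin r → ℕ} {e : Fin s → ℕ}
    (hh : IsBiForm h (d, e)) (hd : d ≠ 0) : constCoeff h = 0 := by
  by_contra hne
  exact hd (by rw [← hh.weight_eq hne, map_zero])

theorem linearCoeff_eq_zero {h : BiRing K n m} {d : Fin r → ℕ} {e : Fin s → ℕ}
    (hh : IsBiForm h (d, e)) {j : Fin r} (hd : d ≠ Pi.single j 1) (i : Fin (n j + 1)) :
    linearCoeff j i h = 0 := by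
  by_contra hne
  exact hd (by rw [← hh.weight_eq hne, weight_single])

theorem linearCoeff_X_mul_rename (j : Fin r) (a i : Fin (n j + 1)) (g : PolyRing K m) :
    linearCoeff j i (X (Sum.inl ⟨j, a⟩) * rename Sum.inr g) = if a = i then g else 0 := by
  have h : sumAlgEquiv K (Vars n) (Vars m) (rename Sum.inr g) = C g :=
    DFunLike.congr_fun (sumAlgEquiv_comp_rename_inr (R := K) (S₁ := Vars n) (S₂ := Vars m)) g
  rw [linearCoeff, map_mul, sumAlgEquiv_X_inl, h, mul_comm, coeff_C_mul, coeff_X]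
  simp [Finsupp.single_left_inj, mul_ite]

end BiForms

/-! ### Primality and saturation -/

section Contraction

/-- Extending an ideal of a polynomial ring to a larger ground field and contracting it back
does not change it: every linear functional on the
extension field, applied to the coefficients, maps the extended ideal into the original one. -/
theorem comap_map_extension {K L σ : Type*} [Field K] [Field L] [Algebra K L]
    (I : Ideal (MvPolynomial σ K)) :
    (I.map (MvPolynomial.map (σ := σ) (algebraMap K L))).comap
      (MvPolynomial.map (algebraMap K L)) = I := by
  refine le_antisymm (fun f hf => ?_) Ideal.le_comap_map
  obtain ⟨π, hπ⟩ := (Algebra.linearMap K L).exists_leftInverse_of_injective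
    (LinearMap.ker_eq_bot.2 (algebraMap K L).injective)
  have hπ' : ∀ c, π (algebraMap K L c) = c := fun c => DFunLike.congr_fun hπ c
  have key : ∀ g ∈ I.map (MvPolynomial.map (σ := σ) (algebraMap K L)), ∀ π : L →ₗ[K] K,
      ∃ f ∈ I, ∀ a, f.coeff a = π (g.coeff a) := by
    intro g hg
    refine Submodule.span_induction ?_ ?_ ?_ ?_ hg
    · rintro _ ⟨f, hf, rfl⟩ π
      refine ⟨MvPolynomial.C (π 1) * f, I.mul_mem_left _ hf, fun a => ?_⟩
      rw [MvPolynomial.coeff_C_mul, MvPolynomial.coeff_map, Algebra.algebraMap_eq_smul_one,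
        map_smul, smul_eq_mul, mul_comm]
    · exact fun π => ⟨0, I.zero_mem, by simp⟩
    · intro g₁ g₂ _ _ h₁ h₂ π
      obtain ⟨f₁, hf₁, e₁⟩ := h₁ π
      obtain ⟨f₂, hf₂, e₂⟩ := h₂ π
      exact ⟨f₁ + f₂, I.add_mem hf₁ hf₂, fun a => by simp [e₁, e₂]⟩
    · intro b g _ h
      rw [smul_eq_mul, mul_comm]
      induction b using MvPolynomial.induction_on with
      | C c =>
        intro π
        obtain ⟨f, hf, e⟩ := h (π ∘ₗ LinearMap.mulLeft K c)
        exact ⟨f, hf, fun a => by simp [e, mul_comm g]⟩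
      | add p q hp hq =>
        intro π
        obtain ⟨f₁, hf₁, e₁⟩ := hp π
        obtain ⟨f₂, hf₂, e₂⟩ := hq π
        exact ⟨f₁ + f₂, I.add_mem hf₁ hf₂, fun a => by simp [e₁, e₂, mul_add]⟩
      | mul_X p v hp =>
        classical
        intro π
        obtain ⟨f, hf, e⟩ := hp π
        refine ⟨f * MvPolynomial.X v, I.mul_mem_right _ hf, fun a => ?_⟩
        rw [← mul_assoc, MvPolynomial.coeff_mul_X', MvPolynomial.coeff_mul_X', e]
        split_ifs <;> simp
  obtain ⟨f', hf', e⟩ := key _ hf π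
  convert hf'
  ext a
  rw [e, MvPolynomial.coeff_map, hπ']

end Contraction

/-- The ideal is the contraction of its extension to the algebraic closure, which is prime. -/
theorem Variety.ideal_isPrime {K : Type*} [Field K] {r : ℕ} {n : Fin r → ℕ} (X : Variety K n) :
    X.ideal.IsPrime := by
  have := X.absolutelyPrime
  rw [← comap_map_extension (L := AlgebraicClosure K) X.ideal]
  exact Ideal.comap_isPrime _ _

section Saturation

variable {K : Type*} [Field K] {r : ℕ} {n : Fin r → ℕ}

theorem le_saturateBy {A : Type*} [CommRing A] (𝔞 𝔟 : Ideal A) : 𝔞 ≤ saturateBy 𝔞 𝔟 := by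
  refine le_trans (fun x hx => ?_) (le_iSup _ 0)
  rw [Submodule.mem_colon]
  intro y _
  exact Ideal.mul_mem_right _ _ hx

theorem saturateBy_eq_top {A : Type*} [CommRing A] {𝔞 𝔟 : Ideal A} (h : 𝔟 ≤ 𝔞) :
    saturateBy 𝔞 𝔟 = ⊤ := by
  rw [eq_top_iff]
  refine le_trans (fun x _ => ?_) (le_iSup _ 1)
  rw [Submodule.mem_colon]
  intro y hy
  rw [pow_one] at hy
  exact Ideal.mul_mem_left _ _ (h hy)

theorem foldl_saturateBy_eq_top {A ι : Type*} [CommRing A] {B : ι → Ideal A} {j : ι} :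
    ∀ (l : List ι) (𝔞 : Ideal A), (j ∈ l ∧ B j ≤ 𝔞) ∨ 𝔞 = ⊤ →
      l.foldl (fun 𝔠 i => saturateBy 𝔠 (B i)) 𝔞 = ⊤
  | [], 𝔞, h => by simpa using h
  | i :: l, 𝔞, h => by
    rw [List.foldl_cons]
    refine foldl_saturateBy_eq_top (j := j) l _ ?_
    rcases h with ⟨hm, hj⟩ | rfl
    · rcases List.mem_cons.1 hm with rfl | hm
      · exact Or.inr (saturateBy_eq_top hj)
      · exact Or.inl ⟨hm, hj.trans (le_saturateBy _ _)⟩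
    · exact Or.inr (top_le_iff.1 (le_saturateBy _ _))

/-- A multi-saturated proper ideal contains none of the irrelevant ideals. -/
theorem Variety.exists_X_notMem (X : Variety K n) (j : Fin r) :
    ∃ i : Fin (n j + 1), (MvPolynomial.X ⟨j, i⟩ : PolyRing K n) ∉ X.ideal := by
  by_contra! h
  refine X.ideal_isPrime.ne_top ?_
  rw [← X.saturated]
  refine foldl_saturateBy_eq_top (j := j) _ _ (Or.inl ⟨List.mem_finRange j, ?_⟩)
  rw [blockIdeal, Ideal.span_le]
  rintro _ ⟨i, rfl⟩
  exact h i

end Saturation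

/-! ### The multi-projective Nullstellensatz -/

section Points

open MvPolynomial

variable {K : Type*} [Field K] {r : ℕ} {n : Fin r → ℕ}

/-- If `p j = (v j)` in homogeneous coordinates, the value of a form at the chosen coordinates
of `p` is a non-zero multiple of its value at `v`. -/
theorem Point.exists_aeval_coords (p : Point K n)
    (v : ∀ j : Fin r, Fin (n j + 1) → AlgebraicClosure K) (hv : ∀ j, v j ≠ 0)
    (hp : ∀ j, Projectivization.mk _ (v j) (hv j) = p j) (d : Fin r → ℕ) :
    ∃ c : AlgebraicClosure K, c ≠ 0 ∧ ∀ f : PolyRing K n, IsForm f d →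
      aeval p.coords f = c * aeval (fun u : Vars n => v u.1 u.2) f := by
  have h : ∀ j, ∃ a : (AlgebraicClosure K)ˣ, a • v j = (p j).rep := fun j => by
    rw [← hp j]
    exact Projectivization.exists_smul_eq_mk_rep _ (v j) (hv j)
  choose a ha using h
  refine ⟨∏ j, (a j : AlgebraicClosure K) ^ d j,
    Finset.prod_ne_zero_iff.2 fun j _ => pow_ne_zero _ (a j).ne_zero, fun f hf => ?_⟩
  rw [← aeval_scale hf]
  congr 2
  ext u
  rw [Point.coords, ← ha]
  rfl

/-- The multi-projective Nullstellensatz: a form that vanishes at all points of `X` lies in the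
ideal of `X`. -/
theorem Variety.mem_ideal_of_forall_points (X : Variety K n) {f : PolyRing K n} {d : Fin r → ℕ}
    (hf : IsForm f d) (h : ∀ p ∈ X.points, aeval p.coords f = 0) : f ∈ X.ideal := by
  have := X.ideal_isPrime
  choose i hi using X.exists_X_notMem
  -- Multiplying by a variable of each group makes `f` vanish also at the zeros of the ideal in
  -- affine space that do not define a point of the product of projective spaces.
  have hmem : f * ∏ j, (MvPolynomial.X ⟨j, i j⟩ : PolyRing K n) ∈ X.ideal := by
    rw [← IsPrime.vanishingIdeal_zeroLocus (K := AlgebraicClosure K) X.ideal,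
      mem_vanishingIdeal_iff]
    intro v hv
    rw [map_mul, map_prod]
    by_cases h0 : ∀ j, v ⟨j, i j⟩ ≠ 0
    · have hv0 : ∀ j, (fun k => v ⟨j, k⟩) ≠ 0 := fun j h => h0 j (congrFun h (i j))
      let p : Point K n := fun j => Projectivization.mk _ (fun k => v ⟨j, k⟩) (hv0 j)
      have hp : p ∈ X.points := by
        rintro g hg ⟨e, he⟩
        obtain ⟨c, -, hc⟩ := p.exists_aeval_coords (fun j k => v ⟨j, k⟩) hv0 (fun _ => rfl) e
        rw [hc g he]
        exact mul_eq_zero_of_right _ (hv g hg)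
      obtain ⟨c, hc0, hc⟩ := p.exists_aeval_coords (fun j k => v ⟨j, k⟩) hv0 (fun _ => rfl) d
      have := h p hp
      rw [hc f hf, mul_eq_zero, or_iff_right hc0] at this
      exact mul_eq_zero_of_left this _
    · push Not at h0
      obtain ⟨j, hj⟩ := h0
      exact mul_eq_zero_of_right _ (Finset.prod_eq_zero (Finset.mem_univ j) (by simpa using hj))
  rcases this.mem_or_mem hmem with h1 | h1
  · exact h1
  · obtain ⟨j, -, hj⟩ := this.prod_mem_iff.1 h1
    exact absurd hj (hi j)

end Points

/-! ### Classes of forms in the coordinate ring -/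

namespace Variety

open MvPolynomial

variable {K : Type*} [Field K] {r s : ℕ} {n : Fin r → ℕ} {m : Fin s → ℕ}

instance (X : Variety K n) : IsDomain X.CoordRing :=
  (Ideal.Quotient.isDomain_iff_prime _).2 X.ideal_isPrime

/-- `a` is the class of a form of multi-degree `d` in the coordinate ring. -/
def IsFormClass (X : Variety K n) (a : X.CoordRing) (d : Fin r → ℕ) : Prop :=
  ∃ f : PolyRing K n, IsForm f d ∧ Ideal.Quotient.mk X.ideal f = a

variable {X : Variety K n}

theorem IsFormClass.mul {a b : X.CoordRing} {d e : Fin r → ℕ} (ha : X.IsFormClass a d)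
    (hb : X.IsFormClass b e) : X.IsFormClass (a * b) (d + e) := by
  obtain ⟨f, hf, rfl⟩ := ha
  obtain ⟨g, hg, rfl⟩ := hb
  exact ⟨f * g, hf.mul hg, map_mul _ _ _⟩

theorem IsFormClass.sub {a b : X.CoordRing} {d : Fin r → ℕ} (ha : X.IsFormClass a d)
    (hb : X.IsFormClass b d) : X.IsFormClass (a - b) d := by
  obtain ⟨f, hf, rfl⟩ := ha
  obtain ⟨g, hg, rfl⟩ := hb
  exact ⟨f - g, hf.sub hg, map_sub _ _ _⟩

theorem IsFormClass.prod {ι : Type*} (t : Finset ι) {a : ι → X.CoordRing}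
    {d : ι → Fin r → ℕ} (ha : ∀ i, X.IsFormClass (a i) (d i)) :
    X.IsFormClass (∏ i ∈ t, a i) (∑ i ∈ t, d i) := by
  choose f hf hfa using ha
  exact ⟨∏ i ∈ t, f i, IsWeightedHomogeneous.prod _ _ _ fun i _ => hf i, by simp [hfa]⟩

theorem IsFormClass.aeval {g : PolyRing K m} {d : Fin s → ℕ} (hg : IsForm g d)
    {φ : ∀ i : Fin s, Fin (m i + 1) → X.CoordRing} {e : Fin s → Fin r → ℕ}
    (hφ : ∀ i k, X.IsFormClass (φ i k) (e i)) :
    X.IsFormClass (MvPolynomial.aeval (fun v : Vars m => φ v.1 v.2) g) (∑ i, d i • e i) := by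
  choose f hf hfφ using hφ
  refine ⟨_, hg.aeval hf, ?_⟩
  rw [← Ideal.Quotient.mkₐ_eq_mk K, ← AlgHom.comp_apply, comp_aeval]
  simp [hfφ]

theorem isFormClass_X (X : Variety K n) (j : Fin r) (i : Fin (n j + 1)) :
    X.IsFormClass (Ideal.Quotient.mk X.ideal (MvPolynomial.X ⟨j, i⟩)) (Pi.single j 1) :=
  ⟨_, isForm_X j i, rfl⟩

theorem evalAt_mk (p : X.points) (f : PolyRing K n) :
    X.evalAt p (Ideal.Quotient.mk X.ideal f) = MvPolynomial.aeval p.1.coords f := rfl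

theorem evalAt_aeval (p : X.points) {σ : Type*} (φ : σ → X.CoordRing) (g : MvPolynomial σ K) :
    X.evalAt p (MvPolynomial.aeval φ g) = MvPolynomial.aeval (fun v => X.evalAt p (φ v)) g := by
  have h : (X.evalAt p).comp (algebraMap K X.CoordRing) = algebraMap K (AlgebraicClosure K) :=
    RingHom.ext fun c => aeval_C _ c
  rw [map_aeval, h]
  rfl

theorem IsFormClass.eq_zero {a : X.CoordRing} {d : Fin r → ℕ} (ha : X.IsFormClass a d)
    (h : ∀ p, X.evalAt p a = 0) : a = 0 := by
  obtain ⟨f, hf, rfl⟩ := ha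
  exact Ideal.Quotient.eq_zero_iff_mem.2
    (X.mem_ideal_of_forall_points hf fun p hp => h ⟨p, hp⟩)

end Variety

/-! ### Rational maps, dominance and inverses -/

section RationalMaps

open MvPolynomial

variable {K : Type*} [Field K] {r s : ℕ} {n : Fin r → ℕ} {m : Fin s → ℕ}
  {X : Variety K n} {Y : Variety K m}

/-- Two vectors of forms define the same map exactly when they are proportional over the
function field. -/
theorem Variety.sameMap_iff {k : ℕ} {F G : Fin (k + 1) → X.CoordRing} (hF : X.IsFormVector F)
    (hG : X.IsFormVector G) : X.SameMap F G ↔ ∀ a b, F a * G b = F b * G a := by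
  constructor
  · intro h a b
    obtain ⟨-, d, hd⟩ := hF
    obtain ⟨-, e, he⟩ := hG
    rw [← sub_eq_zero]
    have hc : X.IsFormClass (F a * G b - F b * G a) (d + e) :=
      (IsFormClass.mul (hd a) (he b)).sub (IsFormClass.mul (hd b) (he a))
    refine hc.eq_zero fun p => ?_
    rw [map_sub, map_mul, map_mul]
    by_cases hFp : X.evalVec F p = 0
    · have h' : ∀ i, X.evalAt p (F i) = 0 := congrFun hFp
      simp [h']
    by_cases hGp : X.evalVec G p = 0
    · have h' : ∀ i, X.evalAt p (G i) = 0 := congrFun hGp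
      simp [h']
    obtain ⟨c, hc⟩ := (Projectivization.mk_eq_mk_iff' _ _ _ hFp hGp).1 (h p hFp hGp)
    have h' : ∀ i, X.evalAt p (F i) = c * X.evalAt p (G i) := fun i => (congrFun hc i).symm
    rw [h', h']
    ring
  · intro h p hFp hGp
    rw [Projectivization.mk_eq_mk_iff']
    obtain ⟨b, hb⟩ := Function.ne_iff.1 hGp
    refine ⟨X.evalVec F p b / X.evalVec G p b, funext fun a => ?_⟩
    have h' : X.evalVec F p a * X.evalVec G p b = X.evalVec F p b * X.evalVec G p a := by
      simp only [Variety.evalVec, ← map_mul, h a b]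
    rw [Pi.smul_apply, smul_eq_mul, div_mul_eq_mul_div, ← h']
    exact mul_div_cancel_right₀ _ hb

theorem RationalMap.isFormVector {k : ℕ} {φ : RationalMap X k} {F : Fin (k + 1) → X.CoordRing}
    (hF : F ∈ φ.reps) : X.IsFormVector F := by
  obtain ⟨F₀, -, h⟩ := φ.isClass
  rw [h] at hF
  exact hF.1

theorem RationalMap.exists_mem_reps {k : ℕ} (φ : RationalMap X k) : ∃ F, F ∈ φ.reps := by
  obtain ⟨F₀, h₀, h⟩ := φ.isClass
  refine ⟨F₀, ?_⟩
  rw [h]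
  exact ⟨h₀, (Variety.sameMap_iff h₀ h₀).2 fun a b => mul_comm _ _⟩

/-- The representatives of a rational map are the vectors of forms that are proportional to one
of them over the function field. -/
theorem RationalMap.mem_reps_iff {k : ℕ} {φ : RationalMap X k} {F : Fin (k + 1) → X.CoordRing}
    (hF : F ∈ φ.reps) {G : Fin (k + 1) → X.CoordRing} :
    G ∈ φ.reps ↔ X.IsFormVector G ∧ ∀ a b, F a * G b = F b * G a := by
  have hF' := φ.isFormVector hF
  obtain ⟨F₀, h₀, h⟩ := φ.isClass
  rw [h] at hF ⊢
  have h₁ := (Variety.sameMap_iff h₀ hF').1 hF.2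
  refine and_congr_right fun hG => ?_
  rw [Variety.sameMap_iff h₀ hG]
  constructor
  · intro h₂ a b
    obtain ⟨c, hc⟩ := Function.ne_iff.1 h₀.1
    refine mul_left_cancel₀ (mul_ne_zero hc hc) ?_
    linear_combination (-F₀ c * G b) * h₁ a c + F₀ a * F c * h₂ c b + F₀ c * G a * h₁ b c -
      F₀ b * F c * h₂ c a
  · intro h₂ a b
    obtain ⟨c, hc⟩ := Function.ne_iff.1 hF'.1
    refine mul_left_cancel₀ (mul_ne_zero hc hc) ?_
    linear_combination F c * G b * h₁ a c + F₀ c * F a * h₂ c b - F c * G a * h₁ b c -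
      F₀ c * F b * h₂ c a

/-- If `q` is the image of `p` computed with the vectors of forms `F i`, then the values of forms
at `q` are, up to a non-zero factor, the values at `p` of their pullbacks. -/
theorem exists_aeval_coords_eq (p : X.points) (F : ∀ i : Fin s, Fin (m i + 1) → X.CoordRing)
    (hF : ∀ i, X.evalVec (F i) p ≠ 0) (q : Point K m)
    (hq : ∀ i, Projectivization.mk _ (X.evalVec (F i) p) (hF i) = q i) (d : Fin s → ℕ) :
    ∃ c : AlgebraicClosure K, c ≠ 0 ∧ ∀ g : PolyRing K m, IsForm g d →
      aeval q.coords g = c * X.evalAt p (aeval (fun v : Vars m => F v.1 v.2) g) := by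
  obtain ⟨c, hc, h⟩ := q.exists_aeval_coords _ hF hq d
  refine ⟨c, hc, fun g hg => ?_⟩
  rw [h g hg, Variety.evalAt_aeval]
  rfl

/-- The form obtained by substituting representatives of a multi-rational map vanishes
independently of the choice of the representatives. -/
theorem MultiRationalMap.aeval_eq_zero_of_mem_reps {Φ : MultiRationalMap X Y}
    {F F' : ∀ i : Fin s, Fin (m i + 1) → X.CoordRing} (hF : ∀ i, F i ∈ (Φ.comp i).reps)
    (hF' : ∀ i, F' i ∈ (Φ.comp i).reps) {g : PolyRing K m} {d : Fin s → ℕ} (hg : IsForm g d)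
    (h : aeval (fun v : Vars m => F v.1 v.2) g = 0) :
    aeval (fun v : Vars m => F' v.1 v.2) g = 0 := by
  have hne : ∀ i, ∃ b, F i b ≠ 0 := fun i =>
    Function.ne_iff.1 ((Φ.comp i).isFormVector (hF i)).1
  choose b hb using hne
  have h₁ := aeval_scale hg (fun i => F' i (b i)) (fun v => F v.1 v.2)
  have h₂ := aeval_scale hg (fun i => F i (b i)) (fun v => F' v.1 v.2)
  -- `F` and `F'` become equal after each component is multiplied by an entry of the other.
  have heq : (fun v : Vars m => F' v.1 (b v.1) * F v.1 v.2) =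
      fun v => F v.1 (b v.1) * F' v.1 v.2 := by
    ext v
    rw [mul_comm, ((RationalMap.mem_reps_iff (hF v.1)).1 (hF' v.1)).2]
  rw [heq, h₂, h, mul_zero, mul_eq_zero] at h₁
  exact h₁.resolve_left (Finset.prod_ne_zero_iff.2 fun i _ => pow_ne_zero _ (hb i))

/-- Pullback of forms along a dominant multi-rational map is injective. -/
theorem MultiRationalMap.Dominant.mem_ideal {Φ : MultiRationalMap X Y} (hΦ : Φ.Dominant)
    {F : ∀ i : Fin s, Fin (m i + 1) → X.CoordRing} (hF : ∀ i, F i ∈ (Φ.comp i).reps)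
    {g : PolyRing K m} {d : Fin s → ℕ} (hg : IsForm g d)
    (h : aeval (fun v : Vars m => F v.1 v.2) g = 0) : g ∈ Y.ideal := by
  refine Y.mem_ideal_of_forall_points hg (hΦ g d hg fun p q hpq => ?_)
  choose F' hF' hne hq using hpq
  obtain ⟨c, -, hc⟩ := exists_aeval_coords_eq p F' hne q.1 hq d
  rw [hc g hg, aeval_eq_zero_of_mem_reps hF hF' hg h, map_zero, mul_zero]

/-- Pulled back along `Φ`, representatives of the components of the inverse of `Φ` become
proportional to the groups of coordinates on `X`. A representative `G j` of every component is
needed, since `Ψ` has a value only where all its components are defined. -/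
theorem MultiRationalMap.IsInverse.X_mul_aeval_eq_of_family {Φ : MultiRationalMap X Y}
    {Ψ : MultiRationalMap Y X} (hΨ : Φ.IsInverse Ψ)
    {F : ∀ i : Fin s, Fin (m i + 1) → X.CoordRing} (hF : ∀ i, F i ∈ (Φ.comp i).reps)
    (G : ∀ j : Fin r, Fin (n j + 1) → PolyRing K m) {e : Fin r → Fin s → ℕ}
    (hGe : ∀ j k, IsForm (G j k) (e j))
    (hG : ∀ j, (fun k => Ideal.Quotient.mk Y.ideal (G j k)) ∈ (Ψ.comp j).reps)
    (j : Fin r) (a b : Fin (n j + 1)) :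
    Ideal.Quotient.mk X.ideal (MvPolynomial.X ⟨j, a⟩) *
        aeval (fun v : Vars m => F v.1 v.2) (G j b) =
      Ideal.Quotient.mk X.ideal (MvPolynomial.X ⟨j, b⟩) *
        aeval (fun v : Vars m => F v.1 v.2) (G j a) := by
  have hne : ∀ i, ∃ b, F i b ≠ 0 := fun i =>
    Function.ne_iff.1 ((Φ.comp i).isFormVector (hF i)).1
  choose β hβ using hne
  have hne : ∀ j, ∃ k, aeval (fun v : Vars m => F v.1 v.2) (G j k) ≠ 0 := fun j => by
    obtain ⟨k, hk⟩ := Function.ne_iff.1 ((Ψ.comp j).isFormVector (hG j)).1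
    refine ⟨k, fun h0 => hk ?_⟩
    exact Ideal.Quotient.eq_zero_iff_mem.2 (hΨ.dominant.mem_ideal hF (hGe j k) h0)
  choose κ hκ using hne
  have hFd : ∀ i, ∃ d, ∀ k, X.IsFormClass (F i k) d := fun i =>
    ((Φ.comp i).isFormVector (hF i)).2
  choose d hd using hFd
  have hGF : ∀ j k, X.IsFormClass (aeval (fun v : Vars m => F v.1 v.2) (G j k))
      (∑ i, e j i • d i) := fun j k => Variety.IsFormClass.aeval (hGe j k) hd
  rw [← sub_eq_zero]
  have hE := ((X.isFormClass_X j a).mul (hGF j b)).sub ((X.isFormClass_X j b).mul (hGF j a))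
  -- Multiplying by one non-vanishing entry of each vector reduces the identity to the points
  -- where `Φ` and `Ψ ∘ Φ` are given by `F` and `G`; there `Ψ ∘ Φ` is the identity.
  have hprod := (hE.mul (Variety.IsFormClass.prod Finset.univ fun i => hd i (β i))).mul
    (Variety.IsFormClass.prod Finset.univ fun j => hGF j (κ j))
  have hzero := hprod.eq_zero fun p => by
    simp only [map_mul, map_prod]
    by_cases h₁ : ∏ i, X.evalAt p (F i (β i)) = 0
    · rw [h₁, mul_zero, zero_mul]
    by_cases h₂ : ∏ j, X.evalAt p (aeval (fun v : Vars m => F v.1 v.2) (G j (κ j))) = 0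
    · rw [h₂, mul_zero]
    refine mul_eq_zero_of_left (mul_eq_zero_of_left ?_ _) _
    have hFp : ∀ i, X.evalVec (F i) p ≠ 0 := fun i h0 =>
      Finset.prod_ne_zero_iff.1 h₁ i (Finset.mem_univ _) (congrFun h0 (β i))
    let q : Point K m := fun i => Projectivization.mk _ _ (hFp i)
    have hΦq : ∀ i, (Φ.comp i).HasValue p (q i) := fun i => ⟨F i, hF i, hFp i, rfl⟩
    have hq : q ∈ Y.points := Φ.mapsTo p q hΦq
    have hGq : ∀ j, ∃ c : AlgebraicClosure K, c ≠ 0 ∧ ∀ k,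
        Y.evalVec (fun k => Ideal.Quotient.mk Y.ideal (G j k)) ⟨q, hq⟩ k =
          c * X.evalAt p (aeval (fun v : Vars m => F v.1 v.2) (G j k)) := fun j => by
      obtain ⟨c, hc, h⟩ := exists_aeval_coords_eq p F hFp q (fun _ => rfl) (e j)
      exact ⟨c, hc, fun k => h _ (hGe j k)⟩
    choose c hc hcG using hGq
    have hGne : ∀ j, Y.evalVec (fun k => Ideal.Quotient.mk Y.ideal (G j k)) ⟨q, hq⟩ ≠ 0 :=
      fun j h0 => by
        have := congrFun h0 (κ j)
        rw [hcG] at this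
        exact mul_ne_zero (hc j) (Finset.prod_ne_zero_iff.1 h₂ j (Finset.mem_univ _)) this
    let p' : Point K n := fun j => Projectivization.mk _ _ (hGne j)
    have hΨp : ∀ j, (Ψ.comp j).HasValue ⟨q, hq⟩ (p' j) := fun j => ⟨_, hG j, hGne j, rfl⟩
    have hp' : p' ∈ X.points := Ψ.mapsTo _ p' hΨp
    have hpp : (⟨p', hp'⟩ : X.points) = p := hΨ.left_inv p ⟨q, hq⟩ _ hΦq hΨp
    obtain ⟨u, hu⟩ := Projectivization.exists_smul_eq_mk_rep (AlgebraicClosure K) _ (hGne j)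
    have hx : ∀ k, X.evalAt p (Ideal.Quotient.mk X.ideal (MvPolynomial.X ⟨j, k⟩)) =
        u * (c j * X.evalAt p (aeval (fun v : Vars m => F v.1 v.2) (G j k))) := fun k => by
      rw [← hcG, Variety.evalAt_mk, aeval_X, ← hpp]
      exact (congrFun hu k).symm
    rw [map_sub, map_mul, map_mul, hx, hx]
    ring
  rw [mul_eq_zero, mul_eq_zero] at hzero
  refine (hzero.resolve_right ?_).resolve_right ?_
  · exact Finset.prod_ne_zero_iff.2 fun j _ => hκ j
  · exact Finset.prod_ne_zero_iff.2 fun i _ => hβ i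

theorem RationalMap.exists_forms {k : ℕ} {φ : RationalMap X k} {F : Fin (k + 1) → X.CoordRing}
    (hF : F ∈ φ.reps) : ∃ (f : Fin (k + 1) → PolyRing K n) (d : Fin r → ℕ),
      (∀ i, IsForm (f i) d) ∧ (fun i => Ideal.Quotient.mk X.ideal (f i)) = F := by
  obtain ⟨-, d, hd⟩ := φ.isFormVector hF
  choose f hf hfF using hd
  exact ⟨f, d, hf, funext hfF⟩

/-- Pulled back along `Φ`, a representative of a component of the inverse of `Φ` becomes
proportional to the corresponding group of coordinates on `X`. -/
theorem MultiRationalMap.IsInverse.X_mul_aeval_eq {Φ : MultiRationalMap X Y}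
    {Ψ : MultiRationalMap Y X} (hΨ : Φ.IsInverse Ψ)
    {F : ∀ i : Fin s, Fin (m i + 1) → X.CoordRing} (hF : ∀ i, F i ∈ (Φ.comp i).reps)
    {j : Fin r} {G : Fin (n j + 1) → PolyRing K m} {e : Fin s → ℕ}
    (hGe : ∀ k, IsForm (G k) e)
    (hG : (fun k => Ideal.Quotient.mk Y.ideal (G k)) ∈ (Ψ.comp j).reps)
    (a b : Fin (n j + 1)) :
    Ideal.Quotient.mk X.ideal (MvPolynomial.X ⟨j, a⟩) *
        aeval (fun v : Vars m => F v.1 v.2) (G b) =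
      Ideal.Quotient.mk X.ideal (MvPolynomial.X ⟨j, b⟩) *
        aeval (fun v : Vars m => F v.1 v.2) (G a) := by
  have h : ∀ j', ∃ (g : Fin (n j' + 1) → PolyRing K m) (d : Fin s → ℕ),
      (∀ k, IsForm (g k) d) ∧ (fun k => Ideal.Quotient.mk Y.ideal (g k)) ∈ (Ψ.comp j').reps ∧
        ∀ hj : j' = j, ∀ k, g k = G (hj ▸ k) := fun j' => by
    by_cases hj : j' = j
    · subst hj
      exact ⟨G, e, hGe, hG, fun _ _ => rfl⟩
    · obtain ⟨G', hG'⟩ := (Ψ.comp j').exists_mem_reps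
      obtain ⟨g, d, hg, rfl⟩ := RationalMap.exists_forms hG'
      exact ⟨g, d, hg, hG', fun hj' => absurd hj' hj⟩
  choose g d hg hG' hgG using h
  have := hΨ.X_mul_aeval_eq_of_family hF g hg hG' j a b
  rwa [hgG j rfl, hgG j rfl] at this

end RationalMaps

/-! ### Equations of the graph -/

section GraphIdeal

open MvPolynomial

variable {K : Type*} [Field K] {r s : ℕ} {n : Fin r → ℕ} {m : Fin s → ℕ}
  {X : Variety K n} {Y : Variety K m} {F : ∀ i : Fin s, Fin (m i + 1) → PolyRing K n}

/-- Equations of the graph vanish under the substitution `𝐲_i = 𝐅^{(i)}`, that is, `t_i = 1`. -/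
theorem aeval_eq_zero_of_mem_graphIdeal {h : BiRing K n m} (hh : h ∈ graphIdeal X F) :
    aeval (Sum.elim (fun v => Ideal.Quotient.mk X.ideal (MvPolynomial.X v))
      (fun v => Ideal.Quotient.mk X.ideal (F v.1 v.2))) h = 0 := by
  let θ : ExtRing K n m →ₐ[K] X.CoordRing := aeval (Sum.elim (fun _ => 1)
    (Sum.elim (fun v => Ideal.Quotient.mk X.ideal (MvPolynomial.X v))
      (fun v => Ideal.Quotient.mk X.ideal (F v.1 v.2))))
  have hx : θ.comp (rename fun v : Vars n => Sum.inr (Sum.inl v)) =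
      Ideal.Quotient.mkₐ K X.ideal := by
    ext v
    simp [θ]
  have hθ : extGraphIdeal X F ≤ RingHom.ker θ := by
    refine sup_le (Ideal.map_le_iff_le_comap.2 fun f hf => ?_) (iSup_le fun i => ?_)
    · exact (DFunLike.congr_fun hx f).trans (Ideal.Quotient.eq_zero_iff_mem.2 hf)
    · rw [Ideal.span_le]
      rintro _ ⟨k, rfl⟩
      have := DFunLike.congr_fun hx (F i k)
      rw [AlgHom.comp_apply] at this
      simp only [SetLike.mem_coe, RingHom.mem_ker, map_sub, map_mul, this]
      simp [θ]
  have := hθ (show rename Sum.inr h ∈ extGraphIdeal X F from hh)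
  rw [RingHom.mem_ker, aeval_rename] at this
  exact this

/-- A relation `x_a G_b(𝐅) = x_b G_a(𝐅)` on `X` between values of forms of the same multi-degree
gives an equation of the graph: `G(t𝐅)` and `G(𝐅)` differ by a monomial in the `t_i`. -/
theorem sub_mem_graphIdeal {G : PolyRing K m} {G' : PolyRing K m} {e : Fin s → ℕ}
    (hG : IsForm G e) (hG' : IsForm G' e) (v w : Vars n)
    (h : Ideal.Quotient.mk X.ideal (MvPolynomial.X v) *
        aeval (fun u : Vars m => Ideal.Quotient.mk X.ideal (F u.1 u.2)) G =
      Ideal.Quotient.mk X.ideal (MvPolynomial.X w) *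
        aeval (fun u : Vars m => Ideal.Quotient.mk X.ideal (F u.1 u.2)) G') :
    MvPolynomial.X (Sum.inl v) * rename Sum.inr G -
      MvPolynomial.X (Sum.inl w) * rename Sum.inr G' ∈ graphIdeal X F := by
  let π : ExtRing K n m →ₐ[K] ExtRing K n m ⧸ extGraphIdeal X F :=
    Ideal.Quotient.mkₐ K (extGraphIdeal X F)
  let ι : PolyRing K n →ₐ[K] ExtRing K n m ⧸ extGraphIdeal X F :=
    π.comp (rename fun v : Vars n => Sum.inr (Sum.inl v))
  have hι : ∀ f ∈ X.ideal, ι f = 0 := fun f hf =>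
    Ideal.Quotient.eq_zero_iff_mem.2 (le_sup_left (α := Ideal (ExtRing K n m))
      (Ideal.mem_map_of_mem _ hf))
  have hy : ∀ u : Vars m, π (MvPolynomial.X (Sum.inr (Sum.inr u))) =
      π (MvPolynomial.X (Sum.inl u.1)) * ι (F u.1 u.2) := fun u => by
    rw [← sub_eq_zero]
    simp only [ι, AlgHom.comp_apply, ← map_mul, ← map_sub]
    refine Ideal.Quotient.eq_zero_iff_mem.2 (le_sup_right (α := Ideal (ExtRing K n m)) ?_)
    exact Submodule.mem_iSup_of_mem u.1 (Ideal.subset_span ⟨u.2, rfl⟩)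
  have hval : ∀ g : PolyRing K m, IsForm g e → π (rename Sum.inr (rename Sum.inr g)) =
      (∏ i, π (MvPolynomial.X (Sum.inl i)) ^ e i) *
        ι (aeval (fun u : Vars m => F u.1 u.2) g) := fun g hg => by
    rw [rename_rename, ← AlgHom.comp_apply ι, comp_aeval, ← aeval_scale hg,
      ← AlgHom.comp_apply π]
    refine DFunLike.congr_fun (f := π.comp (rename _)) (algHom_ext fun u => ?_) g
    simp [hy]
  have hmk : ∀ g : PolyRing K m,
      aeval (fun u : Vars m => Ideal.Quotient.mk X.ideal (F u.1 u.2)) g =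
        Ideal.Quotient.mk X.ideal (aeval (fun u : Vars m => F u.1 u.2) g) := fun g => by
    rw [← Ideal.Quotient.mkₐ_eq_mk K, ← AlgHom.comp_apply, comp_aeval]
  rw [hmk, hmk, ← map_mul, ← map_mul, Ideal.Quotient.eq] at h
  have h0 := hι _ h
  rw [map_sub, map_mul, map_mul] at h0
  refine Ideal.mem_comap.2 (Ideal.Quotient.eq_zero_iff_mem.1 ?_)
  change π _ = 0
  rw [map_sub, map_sub, map_mul, map_mul, map_mul, map_mul, hval G hG,
    hval G' hG', rename_X, rename_X]
  have hX : ∀ v : Vars n, ι (MvPolynomial.X v) = π (MvPolynomial.X (Sum.inr (Sum.inl v))) :=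
    fun v => by simp [ι]
  rw [← hX, ← hX]
  linear_combination (∏ i, π (MvPolynomial.X (Sum.inl i)) ^ e i) * h0

end GraphIdeal

/-! ### Syzygies of the Jacobian dual matrix -/

section JacobianDual

open MvPolynomial

variable {K : Type*} [Field K] {r s : ℕ} {n : Fin r → ℕ} {m : Fin s → ℕ}
  {X : Variety K n} {Y : Variety K m} {F : ∀ i : Fin s, Fin (m i + 1) → PolyRing K n}
  {𝓗 : Set (BiRing K n m)} {j : Fin r}

theorem mem_ker_jacobianDual {v : Fin (n j + 1) → Y.CoordRing} :
    v ∈ LinearMap.ker (jacobianDual Y 𝓗 j).mulVecLin ↔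
      ∀ h ∈ linearForms 𝓗 j, ∑ i, Ideal.Quotient.mk Y.ideal (linearCoeff j i h) * v i = 0 := by
  rw [LinearMap.mem_ker, Matrix.mulVecLin_apply, funext_iff, Subtype.forall]
  rfl

variable {Φ : MultiRationalMap X Y} {Ψ : MultiRationalMap Y X}

/-- A kernel vector of the Jacobian dual matrix is a syzygy of the linear parts of all equations
of the graph, not only of the generators: the linear part of a multiple `a * h` also involves the
degree-zero part of `h`, but that lies in the ideal of `Y`, by dominance. -/
theorem sum_linearCoeff_eq_zero (hΦ : Φ.Dominant)
    (hF : ∀ i, (fun k => Ideal.Quotient.mk X.ideal (F i k)) ∈ (Φ.comp i).reps)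
    (h𝓗 : ∀ h ∈ 𝓗, ∃ d, IsBiForm h d) (hspan : Ideal.span 𝓗 = graphIdeal X F)
    {v : Fin (n j + 1) → Y.CoordRing}
    (hv : v ∈ LinearMap.ker (jacobianDual Y 𝓗 j).mulVecLin)
    {h : BiRing K n m} (hh : h ∈ graphIdeal X F) :
    ∑ i, Ideal.Quotient.mk Y.ideal (linearCoeff j i h) * v i = 0 := by
  suffices H : constCoeff h ∈ Y.ideal ∧
      ∑ i, Ideal.Quotient.mk Y.ideal (linearCoeff j i h) * v i = 0 from H.2
  rw [← hspan] at hh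
  refine Submodule.span_induction ?_ ?_ ?_ ?_ hh
  · intro h hh
    obtain ⟨⟨d, e⟩, hde⟩ := h𝓗 h hh
    constructor
    · by_cases hd : d = 0
      · subst hd
        have h0 := aeval_eq_zero_of_mem_graphIdeal (X := X) (F := F)
          (hspan ▸ Ideal.subset_span hh)
        rw [aeval_eq_constCoeff _ _ hde] at h0
        exact hΦ.mem_ideal hF (hde.coeff 0) h0
      · rw [constCoeff_eq_zero hde hd]
        exact Y.ideal.zero_mem
    · by_cases hd : d = Pi.single j 1
      · subst hd
        exact mem_ker_jacobianDual.1 hv h ⟨hh, e, hde⟩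
      · simp [linearCoeff_eq_zero hde hd]
  · simp [constCoeff, linearCoeff]
  · rintro h h' - - ⟨h₁, h₂⟩ ⟨h₁', h₂'⟩
    constructor
    · simpa [constCoeff] using Y.ideal.add_mem h₁ h₁'
    · have : ∀ i, linearCoeff j i (h + h') = linearCoeff j i h + linearCoeff j i h' :=
        fun i => by simp [linearCoeff]
      simp only [this, map_add, add_mul, Finset.sum_add_distrib, h₂, h₂', add_zero]
  · rintro a h - ⟨h₁, h₂⟩
    rw [smul_eq_mul]
    constructor
    · rw [constCoeff_mul]
      exact Y.ideal.mul_mem_left _ h₁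
    · have h0 : Ideal.Quotient.mk Y.ideal (constCoeff h) = 0 :=
        Ideal.Quotient.eq_zero_iff_mem.2 h₁
      simp only [linearCoeff_mul, map_add, map_mul, h0, mul_zero, add_zero, mul_assoc,
        ← Finset.mul_sum, h₂]

/-- Representatives of the inverse are syzygies of the Jacobian dual matrix. -/
theorem mem_ker_of_mem_reps (hΨ : Φ.IsInverse Ψ)
    (hF : ∀ i, (fun k => Ideal.Quotient.mk X.ideal (F i k)) ∈ (Φ.comp i).reps)
    (hspan : Ideal.span 𝓗 = graphIdeal X F) {G : Fin (n j + 1) → Y.CoordRing}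
    (hG : G ∈ (Ψ.comp j).reps) : G ∈ LinearMap.ker (jacobianDual Y 𝓗 j).mulVecLin := by
  rw [mem_ker_jacobianDual]
  rintro h ⟨hh, d, hd⟩
  obtain ⟨g, e, hg, rfl⟩ := RationalMap.exists_forms hG
  have h0 := aeval_eq_zero_of_mem_graphIdeal (X := X) (F := F) (hspan ▸ Ideal.subset_span hh)
  rw [aeval_eq_sum_linearCoeff _ _ hd] at h0
  simp only [← map_mul, ← map_sum]
  refine Ideal.Quotient.eq_zero_iff_mem.2 (hΨ.dominant.mem_ideal (d := d + e) hF
    (IsWeightedHomogeneous.sum _ _ _ fun i _ => (hd.coeff _).mul (hg i)) ?_)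
  obtain ⟨b, hb⟩ := X.exists_X_notMem j
  have hb : Ideal.Quotient.mk X.ideal (MvPolynomial.X ⟨j, b⟩) ≠ 0 :=
    fun h => hb (Ideal.Quotient.eq_zero_iff_mem.1 h)
  refine (mul_eq_zero.1 ?_).resolve_left hb
  rw [map_sum, Finset.mul_sum, ← zero_mul (aeval (fun v : Vars m =>
    Ideal.Quotient.mk X.ideal (F v.1 v.2)) (g b)), ← h0, Finset.sum_mul]
  refine Finset.sum_congr rfl fun i _ => ?_
  rw [map_mul]
  linear_combination aeval (fun v : Vars m => Ideal.Quotient.mk X.ideal (F v.1 v.2))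
    (linearCoeff j i h) * hΨ.X_mul_aeval_eq hF hg hG b i

/-- Syzygies of the Jacobian dual matrix are proportional to the representatives of the inverse:
the graph satisfies the linear equations `x_a G_b(𝐲) = x_b G_a(𝐲)`. -/
theorem mul_eq_mul_of_mem_ker (hΨ : Φ.IsInverse Ψ)
    (hF : ∀ i, (fun k => Ideal.Quotient.mk X.ideal (F i k)) ∈ (Φ.comp i).reps)
    (h𝓗 : ∀ h ∈ 𝓗, ∃ d, IsBiForm h d) (hspan : Ideal.span 𝓗 = graphIdeal X F)
    {G : Fin (n j + 1) → Y.CoordRing} (hG : G ∈ (Ψ.comp j).reps)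
    {v : Fin (n j + 1) → Y.CoordRing}
    (hv : v ∈ LinearMap.ker (jacobianDual Y 𝓗 j).mulVecLin) (a b : Fin (n j + 1)) :
    G a * v b = G b * v a := by
  obtain ⟨g, e, hg, rfl⟩ := RationalMap.exists_forms hG
  have := sum_linearCoeff_eq_zero hΨ.dominant hF h𝓗 hspan hv
    (sub_mem_graphIdeal (hg b) (hg a) ⟨j, a⟩ ⟨j, b⟩ (hΨ.X_mul_aeval_eq hF hg hG a b))
  have hlin : ∀ i (p q : BiRing K n m),
      linearCoeff j i (p - q) = linearCoeff j i p - linearCoeff j i q :=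
    fun i p q => by simp [linearCoeff]
  simp only [hlin, linearCoeff_X_mul_rename, map_sub, sub_mul, Finset.sum_sub_distrib,
    apply_ite (Ideal.Quotient.mk Y.ideal), map_zero, ite_mul, zero_mul, Finset.sum_ite_eq,
    Finset.mem_univ, if_true] at this
  exact (sub_eq_zero.1 this).symm

theorem weightedHomogeneousComponent_mul {f g : PolyRing K m} {d e : Fin s → ℕ}
    (hf : IsForm f e) : weightedHomogeneousComponent (weight m) (e + d) (f * g) =
      f * weightedHomogeneousComponent (weight m) d g := by
  classical
  have hfin := weightedHomogeneousComponent_finsupp (w := weight m) g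
  conv_lhs => rw [← sum_weightedHomogeneousComponent (weight m) g, finsum_eq_sum _ hfin]
  rw [Finset.mul_sum, map_sum, Finset.sum_congr rfl fun d' _ =>
    weightedHomogeneousComponent_of_mem
      (hf.mul (weightedHomogeneousComponent_isWeightedHomogeneous d' g))]
  simp only [add_right_inj, Finset.sum_ite_eq]
  split_ifs with hd
  · rfl
  · rw [Function.notMem_support.1 fun h => hd (hfin.mem_toFinset.2 h), mul_zero]

/-- The kernel of the Jacobian dual matrix is graded, hence generated by vectors of forms. -/
theorem ker_le_span_formVectors :
    LinearMap.ker (jacobianDual Y 𝓗 j).mulVecLin ≤ Submodule.span Y.CoordRing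
      {G | Y.IsFormVector G ∧ G ∈ LinearMap.ker (jacobianDual Y 𝓗 j).mulVecLin} := by
  classical
  intro v hv
  choose f hf using fun i => Ideal.Quotient.mk_surjective (v i)
  let c : (Fin s → ℕ) → Fin (n j + 1) → Y.CoordRing := fun d i =>
    Ideal.Quotient.mk Y.ideal (weightedHomogeneousComponent (weight m) d (f i))
  have hfin : ∀ i, (Function.support fun d =>
      weightedHomogeneousComponent (weight m) d (f i)).Finite := fun i =>
    weightedHomogeneousComponent_finsupp (f i)
  let D : Finset (Fin s → ℕ) := Finset.univ.biUnion fun i => (hfin i).toFinset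
  have hsum : v = ∑ d ∈ D, c d := by
    ext i
    rw [Finset.sum_apply, ← hf i, ← map_sum]
    congr 1
    conv_lhs => rw [← sum_weightedHomogeneousComponent (weight m) (f i)]
    refine finsum_eq_sum_of_support_subset _ fun d hd => ?_
    exact Finset.mem_coe.2 (Finset.mem_biUnion.2 ⟨i, Finset.mem_univ _, (hfin i).mem_toFinset.2 hd⟩)
  rw [hsum]
  refine Submodule.sum_mem _ fun d _ => ?_
  by_cases h0 : c d = 0
  · rw [h0]
    exact Submodule.zero_mem _
  refine Submodule.subset_span ⟨⟨h0, d, fun i => ⟨_,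
    weightedHomogeneousComponent_isWeightedHomogeneous d (f i), rfl⟩⟩, ?_⟩
  rw [mem_ker_jacobianDual] at hv ⊢
  rintro h ⟨hh, e, he⟩
  have h1 := hv h ⟨hh, e, he⟩
  simp only [← hf, ← map_mul, ← map_sum] at h1
  have h2 := Y.homogeneous _ (Ideal.Quotient.eq_zero_iff_mem.1 h1) (e + d)
  simp only [c, ← map_mul, ← map_sum]
  refine Ideal.Quotient.eq_zero_iff_mem.2 ?_
  convert h2
  rw [map_sum]
  refine Finset.sum_congr rfl fun i _ => ?_
  exact (weightedHomogeneousComponent_mul (f := linearCoeff j i h) (he.coeff _)).symm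

end JacobianDual

/-! ### Matrices of corank one and maximal minors -/

section Rank

variable {A : Type*} [CommRing A] [IsDomain A] {ι : Type*} {k : ℕ}

theorem rank_add_finrank_ker (M : Matrix ι (Fin (k + 1)) A) :
    M.rank + Module.finrank A (LinearMap.ker M.mulVecLin) = k + 1 := by
  have := (LinearMap.ker M.mulVecLin).finrank_quotient_add_finrank
  rwa [Module.finrank_fin_fun, M.mulVecLin.quotKerEquivRange.finrank_eq] at this

variable [IsNoetherianRing A]

/-- A matrix with `k + 1` columns whose kernel consists of the vectors proportional to a non-zero
vector has rank `k`. -/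
theorem rank_eq_of_ker {M : Matrix ι (Fin (k + 1)) A} {G : Fin (k + 1) → A} (hG : G ≠ 0)
    (hker : G ∈ LinearMap.ker M.mulVecLin)
    (h : ∀ v ∈ LinearMap.ker M.mulVecLin, ∀ a b, G a * v b = G b * v a) : M.rank = k := by
  obtain ⟨b, hb⟩ := Function.ne_iff.1 hG
  have hinj : Function.Injective
      ((LinearMap.proj b : (Fin (k + 1) → A) →ₗ[A] A) ∘ₗ (LinearMap.ker M.mulVecLin).subtype) := by
    rw [← LinearMap.ker_eq_bot, LinearMap.ker_eq_bot']
    rintro ⟨v, hv⟩ h0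
    ext a
    have h0' : v b = 0 := h0
    have := h v hv b a
    rw [h0', mul_zero] at this
    exact (mul_eq_zero.1 this).resolve_left hb
  have h1 := LinearMap.finrank_le_finrank_of_injective hinj
  rw [Module.finrank_self] at h1
  have : Nontrivial (LinearMap.ker M.mulVecLin) :=
    ⟨⟨⟨G, hker⟩, 0, fun h => hG (congrArg Subtype.val h)⟩⟩
  have h2 : 0 < Module.finrank A (LinearMap.ker M.mulVecLin) :=
    Module.finrank_pos
  have := rank_add_finrank_ker M
  omega

/-- Two vectors in the kernel of a matrix of corank one are proportional. -/
theorem mul_eq_mul_of_rank_eq {M : Matrix ι (Fin (k + 1)) A} (hM : M.rank = k)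
    {v w : Fin (k + 1) → A} (hv : v ∈ LinearMap.ker M.mulVecLin)
    (hw : w ∈ LinearMap.ker M.mulVecLin) (a b : Fin (k + 1)) : v a * w b = v b * w a := by
  have h1 : Module.finrank A (LinearMap.ker M.mulVecLin) = 1 := by
    have := rank_add_finrank_ker M
    omega
  have hdep : ¬ LinearIndependent A
      ![(⟨v, hv⟩ : LinearMap.ker M.mulVecLin), ⟨w, hw⟩] := fun h => by
    have := h.fintype_card_le_finrank
    simp [h1] at this
  rw [LinearIndependent.pair_iff] at hdep
  push Not at hdep
  obtain ⟨x, y, hxy, hne⟩ := hdep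
  have h : ∀ i, x * v i + y * w i = 0 := fun i => congrFun (congrArg Subtype.val hxy) i
  by_cases hx : x = 0
  · refine mul_left_cancel₀ (hne hx) ?_
    linear_combination v a * h b - v b * h a
  · refine mul_left_cancel₀ hx ?_
    linear_combination w b * h a - w a * h b

/-- The vector of signed maximal minors is a syzygy, by expansion of a determinant with a
repeated row. -/
theorem mulVec_signedMinors {A : Type*} [CommRing A] {k : ℕ} (M : Matrix (Fin k) (Fin (k + 1)) A) :
    M.mulVec (signedMinors M) = 0 := by
  ext i
  let N : Matrix (Fin (k + 1)) (Fin (k + 1)) A := Matrix.of (Fin.cons (M i) M)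
  have hN : N.det = 0 := Matrix.det_zero_of_row_eq (Fin.succ_ne_zero i).symm rfl
  rw [Matrix.det_succ_row_zero] at hN
  rw [Pi.zero_apply, ← hN, Matrix.mulVec, dotProduct]
  refine Finset.sum_congr rfl fun a _ => ?_
  rw [signedMinors, show N.submatrix Fin.succ a.succAbove = M.submatrix id a.succAbove from rfl,
    show N 0 a = M i a from rfl]
  ring

/-- The maximal minors of a `k × (k + 1)` matrix of rank `k` are not all zero. If the minor
without the column `b` vanished, with `G b ≠ 0`, the remaining columns would satisfy a relation,
which is a non-zero kernel vector with entry `0` at `b`, not proportional to `G`. -/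
theorem signedMinors_ne_zero {M : Matrix (Fin k) (Fin (k + 1)) A} (hM : M.rank = k)
    {G : Fin (k + 1) → A} (hG : G ≠ 0) (hker : G ∈ LinearMap.ker M.mulVecLin) :
    signedMinors M ≠ 0 := by
  intro h0
  obtain ⟨b, hb⟩ := Function.ne_iff.1 hG
  have hdet : (M.submatrix id b.succAbove).det = 0 := by
    have := congrFun h0 b
    simpa [signedMinors] using this
  obtain ⟨u, hu0, hu⟩ := Matrix.exists_mulVec_eq_zero_iff.2 hdet
  have hv : b.insertNth (0 : A) u ∈ LinearMap.ker M.mulVecLin := by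
    rw [LinearMap.mem_ker, Matrix.mulVecLin_apply, ← hu]
    ext i
    simp [Matrix.mulVec, dotProduct, Fin.sum_univ_succAbove _ b]
  refine hu0 (funext fun a => ?_)
  have := mul_eq_mul_of_rank_eq hM hker hv b (b.succAbove a)
  rw [Fin.insertNth_apply_same, Fin.insertNth_apply_succAbove, mul_zero] at this
  exact (mul_eq_zero.1 this).resolve_left hb

end Rank

section Minors

variable {K : Type*} [Field K] {r s : ℕ} {n : Fin r → ℕ} {m : Fin s → ℕ} {Y : Variety K m}

/-- The minors of a matrix whose rows are vectors of forms are forms of the same multi-degree. -/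
theorem isFormClass_signedMinors {k : ℕ} {M : Matrix (Fin k) (Fin (k + 1)) Y.CoordRing}
    {d : Fin k → Fin s → ℕ} (hM : ∀ i a, Y.IsFormClass (M i a) (d i)) (a : Fin (k + 1)) :
    Y.IsFormClass (signedMinors M a) (∑ i, d i) := by
  choose f hf hfM using hM
  refine ⟨signedMinors (Matrix.of f) a, ?_, ?_⟩
  · rw [signedMinors, Matrix.det_apply']
    have h1 : ((-1) ^ (a : ℕ) : PolyRing K m) = MvPolynomial.C ((-1) ^ (a : ℕ)) := by simp
    rw [h1]
    refine MvPolynomial.IsWeightedHomogeneous.C_mul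
      (MvPolynomial.IsWeightedHomogeneous.sum _ _ _ fun σ _ => ?_) _
    have h2 : ((Equiv.Perm.sign σ : ℤ) : PolyRing K m) =
        MvPolynomial.C ((Equiv.Perm.sign σ : ℤ) : K) := by simp
    rw [h2]
    refine MvPolynomial.IsWeightedHomogeneous.C_mul ?_ _
    rw [← Equiv.sum_comp σ d]
    exact MvPolynomial.IsWeightedHomogeneous.prod _ _ _ fun i _ => hf _ _
  · have hM' : M = (Matrix.of f).map (Ideal.Quotient.mk Y.ideal) := by
      ext i a
      exact (hfM i a).symm
    rw [hM', signedMinors, signedMinors, map_mul, map_pow, map_neg, map_one, RingHom.map_det]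
    rfl

end Minors

end MultiProj

end

theorem mainTheorem2 {K : Type*} [Field K] {r s : ℕ} {n : Fin r → ℕ} {m : Fin s → ℕ}
    (X : MultiProj.Variety K n) (Y : MultiProj.Variety K m)
    (Φ : MultiProj.MultiRationalMap X Y) (Ψ : MultiProj.MultiRationalMap Y X)
    (hΨ : Φ.IsInverse Ψ)
    (F : ∀ i : Fin s, Fin (m i + 1) → MultiProj.PolyRing K n)
    (hF : ∀ i, (fun k => Ideal.Quotient.mk X.ideal (F i k)) ∈ (Φ.comp i).reps)
    (𝓗 : Set (MultiProj.BiRing K n m))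
    (h𝓗 : MultiProj.IsMinimalFormGenerators (MultiProj.graphIdeal X F) 𝓗)
    (j : Fin r) :
    (Ψ.comp j).repModule = LinearMap.ker (MultiProj.jacobianDual Y 𝓗 j).mulVecLin ∧
    (∀ G : Fin (n j + 1) → Y.CoordRing, G ∈ (Ψ.comp j).reps ↔
      Y.IsFormVector G ∧ G ∈ LinearMap.ker (MultiProj.jacobianDual Y 𝓗 j).mulVecLin) ∧
    (MultiProj.jacobianDual Y 𝓗 j).rank = n j ∧
    ∀ ρ : Fin (n j) → MultiProj.linearForms 𝓗 j,
      ((MultiProj.jacobianDual Y 𝓗 j).submatrix ρ id).rank = n j →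
        MultiProj.signedMinors ((MultiProj.jacobianDual Y 𝓗 j).submatrix ρ id) ∈
          (Ψ.comp j).reps := by
  obtain ⟨⟨hform, hspan⟩, -⟩ := h𝓗
  obtain ⟨G₀, hG₀⟩ := (Ψ.comp j).exists_mem_reps
  have hne : G₀ ≠ 0 := ((Ψ.comp j).isFormVector hG₀).1
  have hker₀ := MultiProj.mem_ker_of_mem_reps hΨ hF hspan hG₀
  have hprop : ∀ v ∈ LinearMap.ker (MultiProj.jacobianDual Y 𝓗 j).mulVecLin,
      ∀ a b, G₀ a * v b = G₀ b * v a := fun v hv =>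
    MultiProj.mul_eq_mul_of_mem_ker hΨ hF hform hspan hG₀ hv
  have hreps : ∀ G : Fin (n j + 1) → Y.CoordRing, G ∈ (Ψ.comp j).reps ↔
      Y.IsFormVector G ∧ G ∈ LinearMap.ker (MultiProj.jacobianDual Y 𝓗 j).mulVecLin := fun G =>
    ⟨fun hG => ⟨(Ψ.comp j).isFormVector hG, MultiProj.mem_ker_of_mem_reps hΨ hF hspan hG⟩,
      fun hG => (MultiProj.RationalMap.mem_reps_iff hG₀).2 ⟨hG.1, hprop G hG.2⟩⟩
  refine ⟨le_antisymm ?_ ?_, hreps, MultiProj.rank_eq_of_ker hne hker₀ hprop, fun ρ hρ => ?_⟩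
  · exact Submodule.span_le.2 fun G hG => ((hreps G).1 hG).2
  · refine MultiProj.ker_le_span_formVectors.trans (Submodule.span_mono fun G hG => ?_)
    exact (hreps G).2 hG
  · have hker₁ : G₀ ∈ LinearMap.ker
        ((MultiProj.jacobianDual Y 𝓗 j).submatrix ρ id).mulVecLin :=
      LinearMap.mem_ker.2 (funext fun i => congrFun (LinearMap.mem_ker.1 hker₀) (ρ i))
    have hΔ : _ ∈ LinearMap.ker ((MultiProj.jacobianDual Y 𝓗 j).submatrix ρ id).mulVecLin :=
      LinearMap.mem_ker.2 (MultiProj.mulVec_signedMinors _)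
    refine (MultiProj.RationalMap.mem_reps_iff hG₀).2
      ⟨⟨MultiProj.signedMinors_ne_zero hρ hne hker₁, ?_⟩,
        MultiProj.mul_eq_mul_of_rank_eq hρ hker₁ hΔ⟩
    choose d hd using fun i => (ρ i).2.2
    exact ⟨_, MultiProj.isFormClass_signedMinors fun i a => ⟨_, (hd i).coeff _, rfl⟩⟩
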